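/- Let $n\ge 0$, $\boldsymbol\theta^*\in\mathbb R^n$, and $\boldsymbol Y=\boldsymbol\theta^*+\boldsymbol\xi$, where the random vector $\boldsymbol\xi$ has independent entries $\xi_1,\dots,\xi_n$ with $\mathbf E[\xi_i]=0$, each $\xi_i$ taking values (almost surely) in an interval $I_i$ of length at most $L$; no symmetry of the noise is assumed. Let $\pi_0$ be a probability distribution on $\mathbb R^n$ supported by a set $S_0\subset\mathbb R^n$ (that is, $\boldsymbol\theta\in S_0$ for $\pi_0$-almost every $\boldsymbol\theta$) such that $\mathcal D_0=\sup_{\boldsymbol\theta,\boldsymbol\theta'\in S_0}\|\boldsymbol\theta-\boldsymbol\theta'\|_\infty<\infty$. For $\beta>0$ let $\widehat\pi$ be the (random) probability distribution $$\frac{d\widehat\pi}{d\pi_0}(\boldsymbol\theta)=\frac{\exp\{-\|\boldsymbol Y-\boldsymbol\theta\|^2/\beta\}}{\int_{\mathbb R^n}\exp\{-\|\boldsymbol Y-\boldsymbol u\|^2/\beta\}\,\pi_0(d\boldsymbol u)},$$ let $\widehat{\boldsymbol\theta}=\int_{\mathbb R^n}\boldsymbol\theta\,\widehat\pi(d\boldsymbol\theta)$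 be the exponentially weighted aggregate, and write $\mathrm{Var}_{\pi}(\boldsymbol\theta)=\int\|\boldsymbol\theta\|^2\,\pi(d\boldsymbol\theta)-\|\int\boldsymbol\theta\,\pi(d\boldsymbol\theta)\|^2$, with $\|\cdot\|$ the Euclidean norm. Then, for every $\beta>0$ with $\beta\ge\frac23L\mathcal D_0$, the random variables $\|\widehat{\boldsymbol\theta}-\boldsymbol\theta^*\|^2$ and $\mathrm{Var}_{\widehat\pi}(\boldsymbol\theta)$ are integrable and $$\mathbf E\big[\|\widehat{\boldsymbol\theta}-\boldsymbol\theta^*\|^2\big]\le\inf_{\pi}\Big\{\int_{\mathbb R^n}\|\boldsymbol\theta-\boldsymbol\theta^*\|^2\,\pi(d\boldsymbol\theta)+\beta D_{\rm KL}(\pi\|\pi_0)\Big\}+\Big(\frac{6L^2}{3\beta-2L\mathcal D_0}-1\Big)\mathbf E\big[\mathrm{Var}_{\widehat\pi}(\boldsymbol\theta)\big],$$ where the infimum is over all probability distributions $\pi$ on $\mathbb R^n$, $D_{\rm KL}$ is the Kullback–Leibler divergence (equal to $+\infty$ if $\pi$ is not absolutely continuous with respect to $\pi_0$), and the factor in front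 of the last expectation is read as $+\infty$ if $3\beta=2L\mathcal D_0$, with the convention $\infty\cdot 0=0$. In particular, if $\beta\ge 2L^2+\frac23L\mathcal D_0$, the last term is nonpositive and $$\mathbf E\big[\|\widehat{\boldsymbol\theta}-\boldsymbol\theta^*\|^2\big]\le\inf_{\pi}\Big\{\int_{\mathbb R^n}\|\boldsymbol\theta-\boldsymbol\theta^*\|^2\,\pi(d\boldsymbol\theta)+\beta D_{\rm KL}(\pi\|\pi_0)\Big\}.$$ -/

import Mathlib

open MeasureTheory ProbabilityTheory InformationTheory
open scoped ENNReal

noncomputable section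

namespace EWA

/-- The sup-norm of a vector of `ℝⁿ` (the norm `‖v‖` of `EuclideanSpace` is the Euclidean one). -/
def supNorm {n : ℕ} (v : EuclideanSpace ℝ (Fin n)) : ℝ :=
  ‖(WithLp.ofLp v : Fin n → ℝ)‖

/-- The posterior `π̂` given the observation `y`: the measure whose density with respect to `π₀` is
`exp (-‖y - θ‖² / β) / ∫ exp (-‖y - u‖² / β) π₀(du)`. -/
def posterior {n : ℕ} (π₀ : Measure (EuclideanSpace ℝ (Fin n))) (β : ℝ)
    (y : EuclideanSpace ℝ (Fin n)) : Measure (EuclideanSpace ℝ (Fin n)) :=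
  π₀.tilted (fun θ => -‖y - θ‖ ^ 2 / β)

/-- The exponentially weighted aggregate: the mean of the posterior. -/
def aggregate {n : ℕ} (π₀ : Measure (EuclideanSpace ℝ (Fin n))) (β : ℝ)
    (y : EuclideanSpace ℝ (Fin n)) : EuclideanSpace ℝ (Fin n) :=
  ∫ θ, θ ∂(posterior π₀ β y)

/-- The variance `∫ ‖θ‖² π(dθ) - ‖∫ θ π(dθ)‖²` of a distribution on `ℝⁿ`. -/
def totalVar {n : ℕ} (π : Measure (EuclideanSpace ℝ (Fin n))) : ℝ :=
  (∫ θ, ‖θ‖ ^ 2 ∂π) - ‖∫ θ, θ ∂π‖ ^ 2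

/-- `inf_π { ∫ ‖θ - θ*‖² π(dθ) + β D_KL(π || π₀) }` over all probability distributions `π` on
`ℝⁿ`, as an element of `[0, ∞]`. -/
def oracleBound {n : ℕ} (π₀ : Measure (EuclideanSpace ℝ (Fin n))) (β : ℝ)
    (θstar : EuclideanSpace ℝ (Fin n)) : ℝ≥0∞ :=
  ⨅ (π : Measure (EuclideanSpace ℝ (Fin n))) (_ : IsProbabilityMeasure π),
    ((∫⁻ θ, ENNReal.ofReal (‖θ - θstar‖ ^ 2) ∂π) + ENNReal.ofReal β * klDiv π π₀)

/-- The factor `6 L² / (3 β - 2 L D₀) - 1` for `3 β - 2 L D₀ ≥ 0`, as an extended real number.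
The quotient is taken in `[0, ∞]`, so it is `∞` when the denominator vanishes and `L ≠ 0`. -/
def varianceFactor (L D₀ β : ℝ) : EReal :=
  ((ENNReal.ofReal (6 * L ^ 2) / ENNReal.ofReal (3 * β - 2 * L * D₀) : ℝ≥0∞) : EReal) - 1

end EWA

end

/-! ### Bernstein's inequality for the exponential. -/

namespace EWA

/-! Write `G x` for `logPartition` at noise `x` and `m x` for the posterior mean minus `θ*`. Up to a
factor free of `θ`, the posterior density is the exponential of a function affine in `x`, so `G` is
convex with gradient `2 m / β`, and its increments are log-Laplace transforms under the posterior.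
Jensen's inequality under the posterior (`norm_sq_aggregate_sub_le`) gives `‖m‖² ≤ 2⟨x, m⟩ - Var - β
G x`.

After averaging over the noise, convexity and centering give `E G(ξ) ≥ G 0`
(`logPartition_zero_le_integral`), and Donsker–Varadhan bounds `-β G 0` by the oracle infimum
(`logPartition_zero_le_oracleBound`).

It remains to bound `2 E⟨ξ, m⟩`, one coordinate at a time (`integral_apply_mul_aggregate_sub_le`).
Replacing `ξ_i` by an independent copy `ξ'_i` preserves the law, so the mean increment of `G` is
zero. Bernstein bounds `β` times that increment by `2 (ξ'_i - ξ_i) m_i + C Var_i` with `C = 6L²/(3β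
- 2LD₀)`. Since `ξ'_i` is centered and independent of `m_i`, this leaves `2 E[ξ_i m_i] ≤ C E Var_i`.
Only `|ξ'_i - ξ_i| ≤ L` enters, hence no symmetry is needed. -/

theorem two_mul_three_pow_le_factorial (k : ℕ) : 2 * 3 ^ k ≤ (k + 2).factorial := by
  induction k with
  | zero => simp
  | succ k ih =>
    rw [show k + 1 + 2 = (k + 2) + 1 by ring, Nat.factorial_succ, pow_succ]
    nlinarith [Nat.factorial_pos (k + 2)]

/-- From order two on, the exponential series is dominated by a geometric series of ratio `b / 3`,
because `(k + 2)! ≥ 2 * 3 ^ k`. -/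
theorem exp_sub_le_bernstein {x b : ℝ} (hx : |x| ≤ b) (hb : b < 3) :
    Real.exp x ≤ 1 + x + x ^ 2 / (2 * (1 - b / 3)) := by
  have h0 : 0 ≤ |x| := abs_nonneg x
  have hb0 : 0 ≤ b := h0.trans hx
  have hexp : HasSum (fun k : ℕ => x ^ k / k.factorial) (Real.exp x) := by
    rw [Real.exp_eq_exp_ℝ]
    exact NormedSpace.expSeries_div_hasSum_exp x
  have htail := (hasSum_nat_add_iff' 2).mpr hexp
  have hgeom := (hasSum_geometric_of_lt_one (r := b / 3) (by positivity) (by linarith)).mul_left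
    (x ^ 2 / 2)
  have hle := hasSum_le (fun k => ?_) htail hgeom
  · simp only [Finset.sum_range_succ, Finset.range_zero, Finset.sum_empty, pow_zero,
      Nat.factorial_zero, Nat.factorial_one, pow_one] at hle
    have : x ^ 2 / 2 * (1 - b / 3)⁻¹ = x ^ 2 / (2 * (1 - b / 3)) := by
      rw [div_mul_eq_div_div, div_eq_mul_inv _ (1 - b / 3)]
    rw [this] at hle
    norm_num at hle
    linarith
  · have hf : (2 * 3 ^ k : ℝ) ≤ ((k + 2).factorial : ℝ) := by
      exact_mod_cast two_mul_three_pow_le_factorial k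
    calc x ^ (k + 2) / ((k + 2).factorial : ℝ)
        ≤ |x| ^ (k + 2) / ((k + 2).factorial : ℝ) := by
          rw [← abs_pow]
          gcongr
          exact le_abs_self _
      _ ≤ |x| ^ (k + 2) / (2 * 3 ^ k) := by gcongr
      _ = x ^ 2 / 2 * (|x| / 3) ^ k := by
          rw [pow_add, sq_abs, div_pow]; field_simp
      _ ≤ x ^ 2 / 2 * (b / 3) ^ k := by gcongr

/-! ### Log-Laplace transforms, tilted measures and relative entropy. -/

section Probability

variable {α : Type*} [MeasurableSpace α] {μ : Measure α} [IsProbabilityMeasure μ]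

theorem integrable_of_ae_abs_le {f : α → ℝ} (hf : AEStronglyMeasurable f μ) {K : ℝ}
    (hK : ∀ᵐ x ∂μ, |f x| ≤ K) : Integrable f μ :=
  Integrable.of_bound hf K (by simpa [Real.norm_eq_abs] using hK)

theorem integrable_exp_of_ae_abs_le {f : α → ℝ} (hf : AEStronglyMeasurable f μ) {K : ℝ}
    (hK : ∀ᵐ x ∂μ, |f x| ≤ K) : Integrable (fun x => Real.exp (f x)) μ := by
  refine Integrable.of_bound (Real.continuous_exp.comp_aestronglyMeasurable hf) (Real.exp K) ?_
  filter_upwards [hK] with x hx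
  rw [Real.norm_eq_abs, abs_of_pos (Real.exp_pos _)]
  exact Real.exp_le_exp.mpr (le_of_abs_le hx)

/-- Jensen's inequality for the exponential. -/
theorem integral_le_log_integral_exp {f : α → ℝ} (hf : Integrable f μ)
    (he : Integrable (fun x => Real.exp (f x)) μ) :
    ∫ x, f x ∂μ ≤ Real.log (∫ x, Real.exp (f x) ∂μ) := by
  rw [Real.le_log_iff_exp_le (integral_exp_pos he)]
  set m := ∫ x, f x ∂μ
  have h1 : ∫ x, (Real.exp m + Real.exp m * (f x - m)) ∂μ = Real.exp m := by
    have hfm : Integrable (fun x => f x - m) μ := hf.sub (integrable_const _)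
    rw [integral_add (integrable_const _) (hfm.const_mul _), integral_const_mul, integral_sub hf (integrable_const _)]
    simp [m]
  rw [← h1]
  refine integral_mono ((integrable_const _).add ((hf.sub (integrable_const _)).const_mul _)) he
    fun x => ?_
  have h2 := Real.add_one_le_exp (f x - m)
  have h3 : Real.exp (f x) = Real.exp m * Real.exp (f x - m) := by
    rw [← Real.exp_add]; ring_nf
  simp only
  rw [h3]
  nlinarith [Real.exp_pos m]

theorem abs_log_integral_exp_le {f : α → ℝ} (hf : AEStronglyMeasurable f μ) {K : ℝ}
    (hK : ∀ᵐ x ∂μ, |f x| ≤ K) : |Real.log (∫ x, Real.exp (f x) ∂μ)| ≤ K := by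
  have he := integrable_exp_of_ae_abs_le hf hK
  rw [abs_le]
  constructor
  · refine le_trans ?_ (integral_le_log_integral_exp (integrable_of_ae_abs_le hf hK) he)
    calc -K = ∫ _, -K ∂μ := by simp
      _ ≤ _ := by
        refine integral_mono_ae (integrable_const _) (integrable_of_ae_abs_le hf hK) ?_
        filter_upwards [hK] with x hx using (abs_le.mp hx).1
  · rw [Real.log_le_iff_le_exp (integral_exp_pos he)]
    calc _ ≤ ∫ _, Real.exp K ∂μ := by
          refine integral_mono_ae he (integrable_const _) ?_
          filter_upwards [hK] with x hx using Real.exp_le_exp.mpr (abs_le.mp hx).2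
      _ = _ := by simp

/-- Bernstein's bound on the log-Laplace transform of a bounded random variable. -/
theorem log_integral_exp_le_bernstein {f : α → ℝ} (hf : Integrable f μ) {b : ℝ} (hb : b < 3)
    (hfb : ∀ᵐ x ∂μ, |f x - ∫ y, f y ∂μ| ≤ b) :
    Real.log (∫ x, Real.exp (f x) ∂μ) ≤
      ∫ x, f x ∂μ + (∫ x, (f x - ∫ y, f y ∂μ) ^ 2 ∂μ) / (2 * (1 - b / 3)) := by
  set m := ∫ x, f x ∂μ
  have hfm : Integrable (fun x => f x - m) μ := hf.sub (integrable_const _)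
  have he := integrable_exp_of_ae_abs_le hfm.1 hfb
  have hsq : Integrable (fun x => (f x - m) ^ 2) μ := by
    refine integrable_of_ae_abs_le (hfm.1.pow 2) (K := b ^ 2) ?_
    filter_upwards [hfb] with x hx
    rw [abs_pow]
    gcongr
  have h1 : ∫ x, Real.exp (f x) ∂μ = Real.exp m * ∫ x, Real.exp (f x - m) ∂μ := by
    rw [← integral_const_mul]
    refine integral_congr_ae (.of_forall fun x => ?_)
    simp only
    rw [← Real.exp_add]; ring_nf
  rw [h1, Real.log_mul (Real.exp_pos _).ne' (integral_exp_pos he).ne', Real.log_exp]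
  gcongr
  have h2 : ∫ x, Real.exp (f x - m) ∂μ ≤ 1 + (∫ x, (f x - m) ^ 2 ∂μ) / (2 * (1 - b / 3)) := by
    calc _ ≤ ∫ x, (1 + (f x - m) + (f x - m) ^ 2 / (2 * (1 - b / 3))) ∂μ := by
          refine integral_mono_ae he (((integrable_const _).add hfm).add (hsq.div_const _)) ?_
          filter_upwards [hfb] with x hx using exp_sub_le_bernstein hx hb
      _ = _ := by
          have h3 : Integrable (fun x => 1 + (f x - m)) μ := (integrable_const _).add hfm
          rw [integral_add h3 (hsq.div_const _), integral_add (integrable_const _) hfm, integral_div,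
            integral_sub hf (integrable_const _)]
          simp [m]
  have := Real.log_le_sub_one_of_pos (integral_exp_pos he)
  linarith

theorem log_integral_exp_tilted {f g : α → ℝ} (hf : Integrable (fun x => Real.exp (f x)) μ)
    (hfg : Integrable (fun x => Real.exp ((f + g) x)) μ) :
    Real.log (∫ x, Real.exp (g x) ∂(μ.tilted f)) =
      Real.log (∫ x, Real.exp ((f + g) x) ∂μ) - Real.log (∫ x, Real.exp (f x) ∂μ) := by
  rw [integral_exp_tilted, Real.log_div (integral_exp_pos hfg).ne' (integral_exp_pos hf).ne']

/-- Jensen for `-f` under the tilted measure, where `exp (-f)` has integral `1 / ∫ exp f ∂μ`. -/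
theorem log_integral_exp_le_integral_tilted {f : α → ℝ} (hf : AEStronglyMeasurable f μ) {K : ℝ}
    (hK : ∀ᵐ x ∂μ, |f x| ≤ K) :
    Real.log (∫ x, Real.exp (f x) ∂μ) ≤ ∫ x, f x ∂(μ.tilted f) := by
  have he := integrable_exp_of_ae_abs_le hf hK
  have := isProbabilityMeasure_tilted he
  have hac := tilted_absolutelyContinuous μ f
  have hK' : ∀ᵐ x ∂(μ.tilted f), |(-f) x| ≤ K := by
    simp only [Pi.neg_apply, abs_neg]
    exact hac.ae_le hK
  have h1 := integral_le_log_integral_exp (integrable_of_ae_abs_le (hf.neg.mono_ac hac) hK')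
    (integrable_exp_of_ae_abs_le (hf.neg.mono_ac hac) hK')
  rw [log_integral_exp_tilted he (by simp)] at h1
  simp [integral_neg] at h1
  linarith

/-- The Donsker–Varadhan inequality for a bounded function. -/
theorem integral_sub_log_integral_exp_le_klDiv {ν : Measure α} [IsProbabilityMeasure ν]
    {f : α → ℝ} (hf : AEStronglyMeasurable f μ) {K : ℝ}
    (hK : ∀ᵐ x ∂μ, |f x| ≤ K) (hkl : klDiv ν μ ≠ ∞) :
    ∫ x, f x ∂ν - Real.log (∫ x, Real.exp (f x) ∂μ) ≤ (klDiv ν μ).toReal := by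
  obtain ⟨hac, hint⟩ := klDiv_ne_top_iff.mp hkl
  have he := integrable_exp_of_ae_abs_le hf hK
  have := isProbabilityMeasure_tilted he
  have hfν : Integrable f ν := integrable_of_ae_abs_le (hf.mono_ac hac) (hac.ae_le hK)
  -- The slack in the inequality is the divergence of `ν` from `μ.tilted f`, which is nonnegative.
  have h1 := integral_llr_tilted_right hac hfν he hint
  have h2 := integral_llr_add_sub_measure_univ_nonneg
    (hac.trans (absolutelyContinuous_tilted he)) (integrable_llr_tilted_right hac hfν hint he)
  have h3 := toReal_klDiv hac hint
  simp at h2 h3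
  linarith

end Probability

/-! ### Resampling one coordinate of a product measure. -/

section Resample

variable {n : ℕ}

/-- It suffices to test boxes: the preimage of a box frees side `i` of the first factor, which then
has mass one, and puts that side on the new coordinate. -/
theorem map_update_prod_pi {μ : Fin n → Measure ℝ} [∀ i, IsProbabilityMeasure (μ i)] (i : Fin n) :
    ((Measure.pi μ).prod (μ i)).map (fun p : (Fin n → ℝ) × ℝ => Function.update p.1 i p.2) =
      Measure.pi μ := by
  have hm : Measurable (fun p : (Fin n → ℝ) × ℝ => Function.update p.1 i p.2) := by
    fun_prop
  symm
  refine Measure.pi_eq fun s hs => ?_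
  rw [Measure.map_apply hm (MeasurableSet.univ_pi hs)]
  have : (fun p : (Fin n → ℝ) × ℝ => Function.update p.1 i p.2) ⁻¹' Set.univ.pi s =
      (Set.univ.pi (Function.update s i Set.univ)) ×ˢ s i := by
    ext p
    simp only [Set.mem_preimage, Set.mem_univ_pi, Set.mem_prod]
    constructor
    · refine fun h => ⟨fun j => ?_, by simpa using h i⟩
      by_cases hj : j = i
      · subst hj; simp
      · simpa [hj] using h j
    · rintro ⟨h, h'⟩ j
      by_cases hj : j = i
      · subst hj; simpa using h'
      · simpa [hj] using h j
  rw [this, Measure.prod_prod, Measure.pi_pi, ← Finset.prod_erase_mul _ _ (Finset.mem_univ i),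
    ← Finset.prod_erase_mul Finset.univ (fun j => μ j (s j)) (Finset.mem_univ i)]
  simp only [Function.update_self, measure_univ, mul_one]
  congr 1
  refine Finset.prod_congr rfl fun j hj => ?_
  rw [Function.update_of_ne (Finset.ne_of_mem_erase hj)]

/-- Replacing a coordinate of a vector with independent coordinates by an independent copy does
not change the distribution of the vector. -/
theorem map_add_single_prod {ν : Measure (EuclideanSpace ℝ (Fin n))} [IsProbabilityMeasure ν]
    (hν : ν.map (WithLp.ofLp : EuclideanSpace ℝ (Fin n) → Fin n → ℝ) =
      Measure.pi fun j => ν.map fun x => x j) (i : Fin n) :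
    (ν.prod ν).map (fun p => p.1 + EuclideanSpace.single i (p.2 i - p.1 i)) = ν := by
  have hc : ∀ j, Measurable (fun x : EuclideanSpace ℝ (Fin n) => x j) := fun j => by fun_prop
  have hof : Measurable (WithLp.ofLp : EuclideanSpace ℝ (Fin n) → Fin n → ℝ) := by fun_prop
  have hto : Measurable (WithLp.toLp 2 : (Fin n → ℝ) → EuclideanSpace ℝ (Fin n)) := by fun_prop
  have hpm : ∀ j, IsProbabilityMeasure (ν.map fun x => x j) := fun j =>
    Measure.isProbabilityMeasure_map (hc j).aemeasurable
  have h2 := map_update_prod_pi (μ := fun j => ν.map fun x => x j) i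
  have hup : Measurable (fun p : (Fin n → ℝ) × ℝ => Function.update p.1 i p.2) := by fun_prop
  rw [← hν, Measure.map_prod_map _ _ hof (hc i),
    Measure.map_map hup (hof.prodMap (hc i))] at h2
  have h3 := congrArg (Measure.map (WithLp.toLp 2 : (Fin n → ℝ) → EuclideanSpace ℝ (Fin n))) h2
  rw [Measure.map_map hto (hup.comp (hof.prodMap (hc i))), Measure.map_map hto hof] at h3
  have h4 : (WithLp.toLp 2 : (Fin n → ℝ) → EuclideanSpace ℝ (Fin n)) ∘ WithLp.ofLp = id := rfl
  rw [h4, Measure.map_id] at h3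
  convert h3 using 2
  funext p
  ext j
  by_cases hj : j = i
  · subst hj; simp
  · simp [hj]

end Resample

end EWA

/-! ### The posterior, its moments and the log-partition function. -/

noncomputable section

namespace EWA

variable {n : ℕ}

/-- The exponent of the posterior density at the observation `θs + x`, up to a constant. -/
def tiltExponent (β : ℝ) (θs x θ : EuclideanSpace ℝ (Fin n)) : ℝ :=
  (2 * inner ℝ x (θ - θs) - ‖θ - θs‖ ^ 2) / β

/-- The logarithm of the normalizing constant of the posterior at `θs + x`. -/
def logPartition (π₀ : Measure (EuclideanSpace ℝ (Fin n))) (β : ℝ)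
    (θs x : EuclideanSpace ℝ (Fin n)) : ℝ :=
  Real.log (∫ θ, Real.exp (tiltExponent β θs x θ) ∂π₀)

/-- The variance of the `i`-th coordinate under the posterior at `θs + x`. -/
def coordVar (π₀ : Measure (EuclideanSpace ℝ (Fin n))) (β : ℝ)
    (θs x : EuclideanSpace ℝ (Fin n)) (i : Fin n) : ℝ :=
  (∫ θ, ((θ - θs) i) ^ 2 ∂(posterior π₀ β (θs + x))) - ((aggregate π₀ β (θs + x) - θs) i) ^ 2

theorem continuous_tiltExponent (β : ℝ) (θs : EuclideanSpace ℝ (Fin n)) :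
    Continuous (fun p : EuclideanSpace ℝ (Fin n) × EuclideanSpace ℝ (Fin n) =>
      tiltExponent β θs p.1 p.2) := by
  unfold tiltExponent
  fun_prop

theorem aestronglyMeasurable_tiltExponent (π : Measure (EuclideanSpace ℝ (Fin n))) (β : ℝ)
    (θs x : EuclideanSpace ℝ (Fin n)) : AEStronglyMeasurable (tiltExponent β θs x) π :=
  ((continuous_tiltExponent β θs).comp
    (Continuous.prodMk_right x)).aestronglyMeasurable

theorem abs_tiltExponent_le {β B R : ℝ} (hβ : 0 < β) {θs x θ : EuclideanSpace ℝ (Fin n)}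
    (hB : ‖θ - θs‖ ≤ B) (hR : ‖x‖ ≤ R) :
    |tiltExponent β θs x θ| ≤ (2 * R * B + B ^ 2) / β := by
  rw [tiltExponent, abs_div, abs_of_pos hβ]
  have h1 := abs_real_inner_le_norm x (θ - θs)
  have h2 : ‖x‖ * ‖θ - θs‖ ≤ R * B :=
    mul_le_mul hR hB (norm_nonneg _) ((norm_nonneg _).trans hR)
  have h3 : ‖θ - θs‖ ^ 2 ≤ B ^ 2 := by gcongr
  gcongr
  rw [abs_le] at h1 ⊢
  constructor <;> nlinarith [sq_nonneg ‖θ - θs‖]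

/-- Expanding the square, the term `-‖x‖² / β` does not depend on `θ` and disappears in the
normalization. The remaining exponent is affine in `x`. -/
theorem posterior_eq_tilted (π₀ : Measure (EuclideanSpace ℝ (Fin n))) [IsProbabilityMeasure π₀]
    (β : ℝ) (θs x : EuclideanSpace ℝ (Fin n)) :
    posterior π₀ β (θs + x) = π₀.tilted (tiltExponent β θs x) := by
  have h1 : (fun θ : EuclideanSpace ℝ (Fin n) => -‖θs + x - θ‖ ^ 2 / β) =
      (fun _ => -‖x‖ ^ 2 / β) + tiltExponent β θs x := by
    funext θ
    have : θs + x - θ = x - (θ - θs) := by abel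
    rw [Pi.add_apply, this, norm_sub_sq_real, tiltExponent]
    ring
  rw [posterior, h1, ← tilted_tilted (integrable_const _), tilted_const]

section Bounded

variable {π₀ : Measure (EuclideanSpace ℝ (Fin n))} {β B : ℝ} {θs : EuclideanSpace ℝ (Fin n)}

theorem ae_abs_tiltExponent_le (hβ : 0 < β) (hB : ∀ᵐ θ ∂π₀, ‖θ - θs‖ ≤ B)
    {x : EuclideanSpace ℝ (Fin n)} {R : ℝ} (hR : ‖x‖ ≤ R) :
    ∀ᵐ θ ∂π₀, |tiltExponent β θs x θ| ≤ (2 * R * B + B ^ 2) / β := by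
  filter_upwards [hB] with θ hθ using abs_tiltExponent_le hβ hθ hR

theorem posterior_absolutelyContinuous (π₀ : Measure (EuclideanSpace ℝ (Fin n))) (β : ℝ)
    (y : EuclideanSpace ℝ (Fin n)) : posterior π₀ β y ≪ π₀ :=
  tilted_absolutelyContinuous _ _

theorem ae_posterior_norm_le (hB : ∀ᵐ θ ∂π₀, ‖θ - θs‖ ≤ B) (y : EuclideanSpace ℝ (Fin n)) :
    ∀ᵐ θ ∂(posterior π₀ β y), ‖θ - θs‖ ≤ B :=
  (posterior_absolutelyContinuous π₀ β y).ae_le hB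

variable [IsProbabilityMeasure π₀]

theorem integrable_exp_tiltExponent (hβ : 0 < β) (hB : ∀ᵐ θ ∂π₀, ‖θ - θs‖ ≤ B)
    (x : EuclideanSpace ℝ (Fin n)) :
    Integrable (fun θ => Real.exp (tiltExponent β θs x θ)) π₀ :=
  integrable_exp_of_ae_abs_le (aestronglyMeasurable_tiltExponent _ _ _ _)
    (ae_abs_tiltExponent_le hβ hB le_rfl)

theorem isProbabilityMeasure_posterior (hβ : 0 < β) (hB : ∀ᵐ θ ∂π₀, ‖θ - θs‖ ≤ B)
    (x : EuclideanSpace ℝ (Fin n)) : IsProbabilityMeasure (posterior π₀ β (θs + x)) := by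
  rw [posterior_eq_tilted]
  exact isProbabilityMeasure_tilted (integrable_exp_tiltExponent hβ hB x)

theorem absolutelyContinuous_posterior (hβ : 0 < β) (hB : ∀ᵐ θ ∂π₀, ‖θ - θs‖ ≤ B)
    (x : EuclideanSpace ℝ (Fin n)) : π₀ ≪ posterior π₀ β (θs + x) := by
  rw [posterior_eq_tilted]
  exact absolutelyContinuous_tilted (integrable_exp_tiltExponent hβ hB x)

/-- The density is jointly measurable in observation and parameter, so measurability of parametric
integrals applies to the normalizing constant and then to the weighted integral. -/
theorem stronglyMeasurable_integral_posterior {F : Type*} [NormedAddCommGroup F] [NormedSpace ℝ F]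
    [SecondCountableTopology F]
    (β : ℝ) (θs : EuclideanSpace ℝ (Fin n)) {g : EuclideanSpace ℝ (Fin n) → F}
    (hg : Continuous g) :
    StronglyMeasurable (fun x => ∫ θ, g θ ∂(posterior π₀ β (θs + x))) := by
  simp_rw [posterior_eq_tilted, integral_tilted]
  have hE := (Real.continuous_exp.comp (continuous_tiltExponent β θs)).stronglyMeasurable
  have hZ : StronglyMeasurable (fun x : EuclideanSpace ℝ (Fin n) =>
      ∫ θ, Real.exp (tiltExponent β θs x θ) ∂π₀) := hE.integral_prod_right' (ν := π₀)
  have hq : StronglyMeasurable (fun p : EuclideanSpace ℝ (Fin n) × EuclideanSpace ℝ (Fin n) =>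
      (Real.exp (tiltExponent β θs p.1 p.2) / ∫ θ, Real.exp (tiltExponent β θs p.1 θ) ∂π₀) •
        g p.2) :=
    (hE.div (hZ.comp_measurable measurable_fst)).smul
      (hg.comp continuous_snd).stronglyMeasurable
  exact hq.integral_prod_right' (ν := π₀)

theorem stronglyMeasurable_logPartition (β : ℝ) (θs : EuclideanSpace ℝ (Fin n)) :
    StronglyMeasurable (logPartition π₀ β θs) := by
  have hE := (Real.continuous_exp.comp (continuous_tiltExponent β θs)).stronglyMeasurable
  exact (Real.measurable_log.comp (hE.integral_prod_right' (ν := π₀)).measurable).stronglyMeasurable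

theorem stronglyMeasurable_aggregate (β : ℝ) (θs : EuclideanSpace ℝ (Fin n)) :
    StronglyMeasurable (fun x => aggregate π₀ β (θs + x)) :=
  stronglyMeasurable_integral_posterior β θs continuous_id

theorem stronglyMeasurable_totalVar (β : ℝ) (θs : EuclideanSpace ℝ (Fin n)) :
    StronglyMeasurable (fun x => totalVar (posterior π₀ β (θs + x))) :=
  (stronglyMeasurable_integral_posterior β θs (continuous_norm.pow 2)).sub
    ((stronglyMeasurable_aggregate β θs).norm.pow 2)

theorem stronglyMeasurable_coordVar (β : ℝ) (θs : EuclideanSpace ℝ (Fin n)) (i : Fin n) :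
    StronglyMeasurable (fun x => coordVar π₀ β θs x i) := by
  refine (stronglyMeasurable_integral_posterior β θs (by fun_prop)).sub ?_
  have := (stronglyMeasurable_aggregate (π₀ := π₀) β θs).measurable
  exact Measurable.stronglyMeasurable (by fun_prop)

theorem integrable_posterior_of_le (hβ : 0 < β) (hB : ∀ᵐ θ ∂π₀, ‖θ - θs‖ ≤ B)
    (x : EuclideanSpace ℝ (Fin n)) {F : Type*} [NormedAddCommGroup F] [SecondCountableTopology F]
    {g : EuclideanSpace ℝ (Fin n) → F}
    (hg : Continuous g) {K : ℝ} (hK : ∀ θ, ‖θ - θs‖ ≤ B → ‖g θ‖ ≤ K) :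
    Integrable g (posterior π₀ β (θs + x)) := by
  have := isProbabilityMeasure_posterior hβ hB x
  refine Integrable.of_bound hg.aestronglyMeasurable K ?_
  filter_upwards [ae_posterior_norm_le hB (θs + x)] with θ hθ using hK θ hθ

theorem integrable_sub_posterior (hβ : 0 < β) (hB : ∀ᵐ θ ∂π₀, ‖θ - θs‖ ≤ B)
    (x : EuclideanSpace ℝ (Fin n)) :
    Integrable (fun θ => θ - θs) (posterior π₀ β (θs + x)) :=
  integrable_posterior_of_le hβ hB x (by fun_prop) fun _ h => h

theorem integrable_coord_posterior (hβ : 0 < β) (hB : ∀ᵐ θ ∂π₀, ‖θ - θs‖ ≤ B)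
    (x : EuclideanSpace ℝ (Fin n)) (i : Fin n) :
    Integrable (fun θ => (θ - θs) i) (posterior π₀ β (θs + x)) :=
  integrable_posterior_of_le hβ hB x (by fun_prop) fun θ h =>
    (PiLp.norm_apply_le (θ - θs) i).trans h

theorem integrable_coord_sq_posterior (hβ : 0 < β) (hB : ∀ᵐ θ ∂π₀, ‖θ - θs‖ ≤ B)
    (x : EuclideanSpace ℝ (Fin n)) (i : Fin n) :
    Integrable (fun θ => (θ - θs) i ^ 2) (posterior π₀ β (θs + x)) :=
  integrable_posterior_of_le hβ hB x (K := B ^ 2) (by fun_prop) fun θ h => by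
    rw [norm_pow]
    gcongr
    exact (PiLp.norm_apply_le (θ - θs) i).trans h

theorem integrable_norm_sq_posterior (hβ : 0 < β) (hB : ∀ᵐ θ ∂π₀, ‖θ - θs‖ ≤ B)
    (x : EuclideanSpace ℝ (Fin n)) :
    Integrable (fun θ => ‖θ - θs‖ ^ 2) (posterior π₀ β (θs + x)) :=
  integrable_posterior_of_le hβ hB x (K := B ^ 2) (by fun_prop) fun θ h => by
    rw [norm_pow, norm_norm]
    gcongr

theorem integral_sub_posterior (hβ : 0 < β) (hB : ∀ᵐ θ ∂π₀, ‖θ - θs‖ ≤ B)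
    (x : EuclideanSpace ℝ (Fin n)) :
    ∫ θ, (θ - θs) ∂(posterior π₀ β (θs + x)) = aggregate π₀ β (θs + x) - θs := by
  have := isProbabilityMeasure_posterior hβ hB x
  have hi : Integrable (fun θ => θ) (posterior π₀ β (θs + x)) := by
    refine ((integrable_sub_posterior hβ hB x).add (integrable_const θs)).congr
      (.of_forall fun θ => ?_)
    simp
  rw [integral_sub hi (integrable_const _)]
  simp [aggregate]

theorem integral_inner_posterior (hβ : 0 < β) (hB : ∀ᵐ θ ∂π₀, ‖θ - θs‖ ≤ B)
    (x z : EuclideanSpace ℝ (Fin n)) :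
    ∫ θ, inner ℝ z (θ - θs) ∂(posterior π₀ β (θs + x)) =
      inner ℝ z (aggregate π₀ β (θs + x) - θs) := by
  rw [← integral_sub_posterior hβ hB x, integral_inner (integrable_sub_posterior hβ hB x)]

theorem integral_coord_posterior (hβ : 0 < β) (hB : ∀ᵐ θ ∂π₀, ‖θ - θs‖ ≤ B)
    (x : EuclideanSpace ℝ (Fin n)) (i : Fin n) :
    ∫ θ, (θ - θs) i ∂(posterior π₀ β (θs + x)) = (aggregate π₀ β (θs + x) - θs) i := by
  have h := integral_inner_posterior hβ hB x (EuclideanSpace.single i 1)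
  simp_rw [EuclideanSpace.inner_single_left] at h
  simpa using h

theorem norm_aggregate_sub_le (hβ : 0 < β) (hB : ∀ᵐ θ ∂π₀, ‖θ - θs‖ ≤ B)
    (x : EuclideanSpace ℝ (Fin n)) : ‖aggregate π₀ β (θs + x) - θs‖ ≤ B := by
  have := isProbabilityMeasure_posterior hβ hB x
  rw [← integral_sub_posterior hβ hB x]
  exact (norm_integral_le_of_norm_le_const (ae_posterior_norm_le hB (θs + x))).trans (by simp)

/-- Bias–variance decomposition around `θs`; it shows that `totalVar` is unaffected by recentering.
-/
theorem integral_norm_sq_posterior (hβ : 0 < β) (hB : ∀ᵐ θ ∂π₀, ‖θ - θs‖ ≤ B)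
    (x : EuclideanSpace ℝ (Fin n)) :
    ∫ θ, ‖θ - θs‖ ^ 2 ∂(posterior π₀ β (θs + x)) =
      totalVar (posterior π₀ β (θs + x)) + ‖aggregate π₀ β (θs + x) - θs‖ ^ 2 := by
  have := isProbabilityMeasure_posterior hβ hB x
  have hin : Integrable (fun θ => inner ℝ θs (θ - θs)) (posterior π₀ β (θs + x)) :=
    (integrable_sub_posterior hβ hB x).const_inner θs
  have h1 : ∀ θ : EuclideanSpace ℝ (Fin n),
      ‖θ‖ ^ 2 = ‖θ - θs‖ ^ 2 + (2 * inner ℝ θs (θ - θs) + ‖θs‖ ^ 2) := fun θ => by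
    have : θ = (θ - θs) + θs := by abel
    conv_lhs => rw [this, norm_add_sq_real, real_inner_comm]
    ring
  have h2 : Integrable (fun θ => 2 * inner ℝ θs (θ - θs) + ‖θs‖ ^ 2)
      (posterior π₀ β (θs + x)) := (hin.const_mul 2).add (integrable_const _)
  have h3 : ∫ θ, ‖θ‖ ^ 2 ∂(posterior π₀ β (θs + x)) = ∫ θ, ‖θ - θs‖ ^ 2 ∂(posterior π₀ β (θs + x))
      + (2 * inner ℝ θs (aggregate π₀ β (θs + x) - θs) + ‖θs‖ ^ 2) := by
    rw [integral_congr_ae (.of_forall h1), integral_add (integrable_norm_sq_posterior hβ hB x) h2,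
      integral_add (hin.const_mul 2) (integrable_const _), integral_const_mul,
      integral_inner_posterior hβ hB]
    simp
  have h4 := h1 (aggregate π₀ β (θs + x))
  rw [totalVar, h3]
  change _ = _ - ‖aggregate π₀ β (θs + x)‖ ^ 2 + _
  rw [h4]
  ring

theorem sum_coordVar (hβ : 0 < β) (hB : ∀ᵐ θ ∂π₀, ‖θ - θs‖ ≤ B)
    (x : EuclideanSpace ℝ (Fin n)) :
    ∑ i, coordVar π₀ β θs x i = totalVar (posterior π₀ β (θs + x)) := by
  have h1 := integral_norm_sq_posterior hβ hB x
  simp only [coordVar]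
  rw [Finset.sum_sub_distrib, ← integral_finsetSum _
    fun i _ => integrable_coord_sq_posterior hβ hB x i]
  simp_rw [← EuclideanSpace.real_norm_sq_eq]
  linarith

theorem coordVar_eq (hβ : 0 < β) (hB : ∀ᵐ θ ∂π₀, ‖θ - θs‖ ≤ B)
    (x : EuclideanSpace ℝ (Fin n)) (i : Fin n) :
    coordVar π₀ β θs x i = ∫ θ, ((θ - θs) i - (aggregate π₀ β (θs + x) - θs) i) ^ 2
      ∂(posterior π₀ β (θs + x)) := by
  have := isProbabilityMeasure_posterior hβ hB x
  set m := (aggregate π₀ β (θs + x) - θs) i with hm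
  have h1 : ∀ θ : EuclideanSpace ℝ (Fin n),
      ((θ - θs) i - m) ^ 2 = (θ - θs) i ^ 2 - (2 * m * (θ - θs) i - m ^ 2) := fun θ => by ring
  have hi := (integrable_coord_posterior hβ hB x i).const_mul (2 * m)
  have h2 : Integrable (fun θ => 2 * m * (θ - θs) i - m ^ 2) (posterior π₀ β (θs + x)) :=
    hi.sub (integrable_const _)
  simp_rw [h1]
  rw [integral_sub (integrable_coord_sq_posterior hβ hB x i) h2,
    integral_sub hi (integrable_const _), integral_const_mul, integral_coord_posterior hβ hB x i,
    coordVar, ← hm]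
  simp
  ring

theorem coordVar_nonneg (hβ : 0 < β) (hB : ∀ᵐ θ ∂π₀, ‖θ - θs‖ ≤ B)
    (x : EuclideanSpace ℝ (Fin n)) (i : Fin n) : 0 ≤ coordVar π₀ β θs x i := by
  rw [coordVar_eq hβ hB]
  exact integral_nonneg fun _ => sq_nonneg _

theorem totalVar_nonneg (hβ : 0 < β) (hB : ∀ᵐ θ ∂π₀, ‖θ - θs‖ ≤ B)
    (x : EuclideanSpace ℝ (Fin n)) : 0 ≤ totalVar (posterior π₀ β (θs + x)) := by
  rw [← sum_coordVar hβ hB]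
  exact Finset.sum_nonneg fun i _ => coordVar_nonneg hβ hB x i

theorem totalVar_le (hβ : 0 < β) (hB : ∀ᵐ θ ∂π₀, ‖θ - θs‖ ≤ B)
    (x : EuclideanSpace ℝ (Fin n)) : totalVar (posterior π₀ β (θs + x)) ≤ B ^ 2 := by
  have := isProbabilityMeasure_posterior hβ hB x
  have h1 := integral_norm_sq_posterior hβ hB x
  have h2 : ∫ θ, ‖θ - θs‖ ^ 2 ∂(posterior π₀ β (θs + x)) ≤ B ^ 2 := by
    calc _ ≤ ∫ _, B ^ 2 ∂(posterior π₀ β (θs + x)) := by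
          refine integral_mono_ae (integrable_norm_sq_posterior hβ hB x) (integrable_const _) ?_
          filter_upwards [ae_posterior_norm_le hB (θs + x)] with θ hθ
          gcongr
      _ = _ := by simp
  nlinarith [sq_nonneg ‖aggregate π₀ β (θs + x) - θs‖]

theorem coordVar_le (hβ : 0 < β) (hB : ∀ᵐ θ ∂π₀, ‖θ - θs‖ ≤ B)
    (x : EuclideanSpace ℝ (Fin n)) (i : Fin n) : coordVar π₀ β θs x i ≤ B ^ 2 :=
  (Finset.single_le_sum (fun j _ => coordVar_nonneg hβ hB x j) (Finset.mem_univ i)).trans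
    ((sum_coordVar hβ hB x).trans_le (totalVar_le hβ hB x))

theorem abs_logPartition_le (hβ : 0 < β) (hB : ∀ᵐ θ ∂π₀, ‖θ - θs‖ ≤ B)
    {x : EuclideanSpace ℝ (Fin n)} {R : ℝ} (hR : ‖x‖ ≤ R) :
    |logPartition π₀ β θs x| ≤ (2 * R * B + B ^ 2) / β :=
  abs_log_integral_exp_le (aestronglyMeasurable_tiltExponent _ _ _ _)
    (ae_abs_tiltExponent_le hβ hB hR)

/-- The quadratic risk of the aggregate is controlled by its correlation with the noise. -/
theorem norm_sq_aggregate_sub_le (hβ : 0 < β) (hB : ∀ᵐ θ ∂π₀, ‖θ - θs‖ ≤ B)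
    (x : EuclideanSpace ℝ (Fin n)) :
    ‖aggregate π₀ β (θs + x) - θs‖ ^ 2 ≤ 2 * inner ℝ x (aggregate π₀ β (θs + x) - θs)
      - totalVar (posterior π₀ β (θs + x)) - β * logPartition π₀ β θs x := by
  -- The posterior mean of the exponent equals `(2⟨x, m⟩ - Var - ‖m‖²) / β`, where `m` is the
  -- centered aggregate; Jensen bounds it below by the log-partition.
  have h1 := log_integral_exp_le_integral_tilted
    (aestronglyMeasurable_tiltExponent π₀ β θs x) (ae_abs_tiltExponent_le hβ hB le_rfl)
  rw [← posterior_eq_tilted] at h1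
  simp only [tiltExponent] at h1
  rw [integral_div, integral_sub (((integrable_sub_posterior hβ hB x).const_inner x).const_mul 2)
    (integrable_norm_sq_posterior hβ hB x), integral_const_mul, integral_inner_posterior hβ hB,
    integral_norm_sq_posterior hβ hB, le_div_iff₀ hβ] at h1
  have h2 : logPartition π₀ β θs x =
    Real.log (∫ θ, Real.exp ((2 * inner ℝ x (θ - θs) - ‖θ - θs‖ ^ 2) / β) ∂π₀) := rfl
  rw [← h2] at h1
  linarith

/-- Shifting the noise by `z` tilts the posterior by a linear function of `θ`, so both bounds on
increments reduce to bounds on a log-Laplace transform. -/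
theorem logPartition_sub (hβ : 0 < β) (hB : ∀ᵐ θ ∂π₀, ‖θ - θs‖ ≤ B)
    (x z : EuclideanSpace ℝ (Fin n)) :
    logPartition π₀ β θs (x + z) - logPartition π₀ β θs x =
      Real.log (∫ θ, Real.exp (2 / β * inner ℝ z (θ - θs)) ∂(posterior π₀ β (θs + x))) := by
  have h1 : tiltExponent β θs x + (fun θ => 2 / β * inner ℝ z (θ - θs)) =
      tiltExponent β θs (x + z) := by
    funext θ
    simp only [Pi.add_apply, tiltExponent, inner_add_left]
    ring
  have h2 := integrable_exp_tiltExponent hβ hB (x + z)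
  rw [← h1] at h2
  rw [posterior_eq_tilted, log_integral_exp_tilted (integrable_exp_tiltExponent hβ hB x) h2, h1]
  rfl

/-- Convexity of the log-partition, in subgradient form, through Jensen. -/
theorem le_logPartition_sub (hβ : 0 < β) (hB : ∀ᵐ θ ∂π₀, ‖θ - θs‖ ≤ B)
    (x z : EuclideanSpace ℝ (Fin n)) :
    2 / β * inner ℝ z (aggregate π₀ β (θs + x) - θs) ≤
      logPartition π₀ β θs (x + z) - logPartition π₀ β θs x := by
  have := isProbabilityMeasure_posterior hβ hB x
  have hi := ((integrable_sub_posterior hβ hB x).const_inner z).const_mul (2 / β)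
  have he : Integrable (fun θ => Real.exp (2 / β * inner ℝ z (θ - θs)))
      (posterior π₀ β (θs + x)) := by
    refine integrable_exp_of_ae_abs_le hi.1 (K := 2 / β * (‖z‖ * B)) ?_
    filter_upwards [ae_posterior_norm_le hB (θs + x)] with θ hθ
    rw [abs_mul, abs_of_pos (by positivity)]
    gcongr
    exact (abs_real_inner_le_norm _ _).trans (by gcongr)
  rw [logPartition_sub hβ hB, ← integral_inner_posterior hβ hB, ← integral_const_mul]
  exact integral_le_log_integral_exp hi he

/-- The upper counterpart of the subgradient bound: along a coordinate axis, Bernstein controls the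
second-order remainder by the posterior variance of that coordinate. -/
theorem logPartition_add_single_sub_le (hβ : 0 < β) (hB : ∀ᵐ θ ∂π₀, ‖θ - θs‖ ≤ B)
    {S : Set (EuclideanSpace ℝ (Fin n))} (hS : ∀ᵐ θ ∂π₀, θ ∈ S) {D : ℝ} (i : Fin n)
    (hD : ∀ θ ∈ S, ∀ θ' ∈ S, |θ i - θ' i| ≤ D) {L : ℝ} (hL : 2 * L * D < 3 * β)
    (x : EuclideanSpace ℝ (Fin n)) {t : ℝ} (ht : |t| ≤ L) :
    β * (logPartition π₀ β θs (x + EuclideanSpace.single i t) - logPartition π₀ β θs x) ≤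
      2 * t * (aggregate π₀ β (θs + x) - θs) i +
        6 * L ^ 2 / (3 * β - 2 * L * D) * coordVar π₀ β θs x i := by
  have := isProbabilityMeasure_posterior hβ hB x
  have hSp := (posterior_absolutelyContinuous π₀ β (θs + x)).ae_le hS
  set m := (aggregate π₀ β (θs + x) - θs) i with hm
  have hL0 : 0 ≤ L := (abs_nonneg t).trans ht
  have hc := integrable_coord_posterior hβ hB x i
  -- The posterior mean averages points of `S`, so the deviation is at most the full diameter `D`.
  have hdev : ∀ θ ∈ S, |(θ - θs) i - m| ≤ D := by
    intro θ hθ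
    have h1 : (θ - θs) i - m = ∫ θ', ((θ - θs) i - (θ' - θs) i) ∂(posterior π₀ β (θs + x)) := by
      rw [integral_sub (integrable_const _) hc, integral_coord_posterior hβ hB, ← hm]
      simp
    rw [h1, ← Real.norm_eq_abs]
    refine (norm_integral_le_of_norm_le_const (C := D) ?_).trans (by simp)
    filter_upwards [hSp] with θ' hθ'
    simpa using hD θ hθ θ' hθ'
  have hf : Integrable (fun θ => 2 * t / β * (θ - θs) i) (posterior π₀ β (θs + x)) :=
    hc.const_mul _
  have hmean : ∫ θ, 2 * t / β * (θ - θs) i ∂(posterior π₀ β (θs + x)) = 2 * t / β * m := by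
    rw [integral_const_mul, integral_coord_posterior hβ hB]
  -- `2LD/β` bounds the centered tilt `(2t/β)((θ - θs)_i - m)`; Bernstein's restriction `b < 3` is
  -- exactly `hL`.
  have hb : 2 * L * D / β < 3 := by rw [div_lt_iff₀ hβ]; exact hL
  have key := log_integral_exp_le_bernstein hf hb (by
    rw [hmean]
    filter_upwards [hSp] with θ hθ
    rw [← mul_sub, abs_mul, abs_div, abs_mul, abs_of_pos hβ, abs_two, mul_div_right_comm (2 * L)]
    have := hdev θ hθ
    gcongr)
  rw [hmean] at key
  have h2 : ∫ θ, (2 * t / β * (θ - θs) i - 2 * t / β * m) ^ 2 ∂(posterior π₀ β (θs + x)) =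
      (2 * t / β) ^ 2 * coordVar π₀ β θs x i := by
    rw [coordVar_eq hβ hB, ← integral_const_mul]
    refine integral_congr_ae (.of_forall fun θ => ?_)
    simp only
    rw [← mul_sub, mul_pow]
  rw [h2] at key
  have h3 : logPartition π₀ β θs (x + EuclideanSpace.single i t) - logPartition π₀ β θs x =
      Real.log (∫ θ, Real.exp (2 * t / β * (θ - θs) i) ∂(posterior π₀ β (θs + x))) := by
    rw [logPartition_sub hβ hB]
    congr 2
    funext θ
    congr 1
    rw [EuclideanSpace.inner_single_left]
    simp only [conj_trivial]
    ring
  rw [h3]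
  have hden : 0 < 3 * β - 2 * L * D := by linarith
  have hv := coordVar_nonneg hβ hB x i
  calc _ ≤ β * (2 * t / β * m + (2 * t / β) ^ 2 * coordVar π₀ β θs x i /
        (2 * (1 - 2 * L * D / β / 3))) := by gcongr
    _ = 2 * t * m + 6 * t ^ 2 / (3 * β - 2 * L * D) * coordVar π₀ β θs x i := by
      have : 2 * (1 - 2 * L * D / β / 3) = 2 * (3 * β - 2 * L * D) / (3 * β) := by
        field_simp
      rw [this]
      field_simp
      ring
    _ ≤ _ := by
      have : t ^ 2 ≤ L ^ 2 := sq_le_sq' (by linarith [(abs_le.mp ht).1]) (abs_le.mp ht).2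
      gcongr

end Bounded

end EWA

end

/-! ### The variational bound on the log-partition at zero noise. -/

namespace EWA

variable {n : ℕ} {π₀ : Measure (EuclideanSpace ℝ (Fin n))} [IsProbabilityMeasure π₀] {β B : ℝ}
  {θs : EuclideanSpace ℝ (Fin n)}

/-- At zero noise the exponent is `-‖θ - θs‖² / β`, and Donsker–Varadhan multiplied by `β` is the
claim for each competing distribution. -/
theorem logPartition_zero_le_oracleBound (hβ : 0 < β) (hB : ∀ᵐ θ ∂π₀, ‖θ - θs‖ ≤ B) :
    ((-(β * logPartition π₀ β θs 0) : ℝ) : EReal) ≤ (oracleBound π₀ β θs : EReal) := by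
  suffices h : ENNReal.ofReal (-(β * logPartition π₀ β θs 0)) ≤ oracleBound π₀ β θs by
    calc ((-(β * logPartition π₀ β θs 0) : ℝ) : EReal)
        ≤ ((ENNReal.ofReal (-(β * logPartition π₀ β θs 0)) : ℝ≥0∞) : EReal) := by
          rw [EReal.coe_ennreal_ofReal]
          exact_mod_cast le_max_left _ _
      _ ≤ _ := by exact_mod_cast h
  refine le_iInf₂ fun π hπ => ?_
  by_cases hkl : klDiv π π₀ = ∞
  · rw [hkl, ENNReal.mul_top (by simpa using hβ)]
    simp
  have hac := (klDiv_ne_top_iff.mp hkl).1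
  have hint : Integrable (fun θ => ‖θ - θs‖ ^ 2) π := by
    refine integrable_of_ae_abs_le (K := B ^ 2) (by fun_prop) ?_
    filter_upwards [hac.ae_le hB] with θ hθ
    rw [abs_pow, abs_norm]
    gcongr
  have h1 := integral_sub_log_integral_exp_le_klDiv
    (aestronglyMeasurable_tiltExponent π₀ β θs 0) (ae_abs_tiltExponent_le hβ hB le_rfl) hkl
  have h2 : ∫ θ, tiltExponent β θs 0 θ ∂π = -(∫ θ, ‖θ - θs‖ ^ 2 ∂π) / β := by
    simp only [tiltExponent, inner_zero_left, mul_zero, zero_sub]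
    rw [integral_div, integral_neg]
  rw [h2] at h1
  change _ - logPartition π₀ β θs 0 ≤ _ at h1
  rw [← ofReal_integral_eq_lintegral_ofReal hint (.of_forall fun _ => sq_nonneg _),
    ← ENNReal.ofReal_toReal hkl, ← ENNReal.ofReal_mul hβ.le,
    ← ENNReal.ofReal_add (integral_nonneg fun _ => sq_nonneg _) (by positivity)]
  refine ENNReal.ofReal_le_ofReal ?_
  have h3 := mul_le_mul_of_nonneg_left h1 hβ.le
  rw [mul_sub, mul_div_cancel₀ _ hβ.ne'] at h3
  linarith

/-! ### Averaging over bounded, centered, independent noise. -/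

section Noise

variable {ν : Measure (EuclideanSpace ℝ (Fin n))} {L D : ℝ}

theorem exists_ae_norm_le
    (hL : ∀ i : Fin n, ∃ a b : ℝ, b - a ≤ L ∧ ∀ᵐ x ∂ν, x i ∈ Set.Icc a b) :
    ∃ R, ∀ᵐ x ∂ν, ‖x‖ ≤ R := by
  choose a b _ hab using hL
  refine ⟨√(∑ i, (|a i| + |b i|) ^ 2), ?_⟩
  filter_upwards [ae_all_iff.mpr hab] with x hx
  refine Real.le_sqrt_of_sq_le ?_
  rw [EuclideanSpace.real_norm_sq_eq]
  refine Finset.sum_le_sum fun i _ => ?_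
  rw [← sq_abs]
  gcongr
  rw [abs_le]
  constructor
  · linarith [(hx i).1, neg_abs_le (a i), abs_nonneg (b i)]
  · linarith [(hx i).2, le_abs_self (b i), abs_nonneg (a i)]

variable [IsProbabilityMeasure ν]

theorem integrable_of_norm_le {R : ℝ} (hR : ∀ᵐ x ∂ν, ‖x‖ ≤ R)
    {f : EuclideanSpace ℝ (Fin n) → ℝ} (hf : StronglyMeasurable f) {K : ℝ}
    (hK : ∀ x, ‖x‖ ≤ R → |f x| ≤ K) : Integrable f ν :=
  integrable_of_ae_abs_le hf.aestronglyMeasurable (hR.mono fun x hx => hK x hx)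

theorem integrable_logPartition (hβ : 0 < β) (hB : ∀ᵐ θ ∂π₀, ‖θ - θs‖ ≤ B) {R : ℝ}
    (hR : ∀ᵐ x ∂ν, ‖x‖ ≤ R) : Integrable (logPartition π₀ β θs) ν :=
  integrable_of_norm_le hR (stronglyMeasurable_logPartition β θs)
    fun _ hx => abs_logPartition_le hβ hB hx

theorem integrable_totalVar (hβ : 0 < β) (hB : ∀ᵐ θ ∂π₀, ‖θ - θs‖ ≤ B) :
    Integrable (fun x => totalVar (posterior π₀ β (θs + x))) ν :=
  integrable_of_ae_abs_le (stronglyMeasurable_totalVar β θs).aestronglyMeasurable (K := B ^ 2)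
    (.of_forall fun x => by
      rw [abs_of_nonneg (totalVar_nonneg hβ hB x)]
      exact totalVar_le hβ hB x)

theorem integrable_coordVar (hβ : 0 < β) (hB : ∀ᵐ θ ∂π₀, ‖θ - θs‖ ≤ B) (i : Fin n) :
    Integrable (fun x => coordVar π₀ β θs x i) ν :=
  integrable_of_ae_abs_le (stronglyMeasurable_coordVar β θs i).aestronglyMeasurable (K := B ^ 2)
    (.of_forall fun x => by
      rw [abs_of_nonneg (coordVar_nonneg hβ hB x i)]
      exact coordVar_le hβ hB x i)

theorem stronglyMeasurable_norm_sq_aggregate_sub (β : ℝ) (θs : EuclideanSpace ℝ (Fin n)) :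
    StronglyMeasurable (fun x => ‖aggregate π₀ β (θs + x) - θs‖ ^ 2) :=
  (((stronglyMeasurable_aggregate β θs).sub stronglyMeasurable_const).norm.pow 2)

theorem integrable_norm_sq_aggregate_sub (hβ : 0 < β) (hB : ∀ᵐ θ ∂π₀, ‖θ - θs‖ ≤ B) :
    Integrable (fun x => ‖aggregate π₀ β (θs + x) - θs‖ ^ 2) ν :=
  integrable_of_ae_abs_le (stronglyMeasurable_norm_sq_aggregate_sub β θs).aestronglyMeasurable
    (K := B ^ 2) (.of_forall fun x => by
      have := norm_aggregate_sub_le hβ hB x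
      rw [abs_pow, abs_norm]
      gcongr)

theorem measurable_aggregate_sub_apply (β : ℝ) (θs : EuclideanSpace ℝ (Fin n)) (i : Fin n) :
    Measurable (fun x => (aggregate π₀ β (θs + x) - θs) i) := by
  have := (stronglyMeasurable_aggregate (π₀ := π₀) β θs).measurable
  fun_prop

theorem integrable_aggregate_sub_apply (hβ : 0 < β) (hB : ∀ᵐ θ ∂π₀, ‖θ - θs‖ ≤ B)
    (i : Fin n) : Integrable (fun x => (aggregate π₀ β (θs + x) - θs) i) ν :=
  integrable_of_ae_abs_le (measurable_aggregate_sub_apply β θs i).aestronglyMeasurable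
    (K := B) (.of_forall fun x => (PiLp.norm_apply_le (aggregate π₀ β (θs + x) - θs) i).trans
      (norm_aggregate_sub_le hβ hB x))

theorem integrable_apply {R : ℝ} (hR : ∀ᵐ x ∂ν, ‖x‖ ≤ R) (i : Fin n) :
    Integrable (fun x : EuclideanSpace ℝ (Fin n) => x i) ν :=
  integrable_of_norm_le hR (Measurable.stronglyMeasurable (by fun_prop))
    fun x hx => (PiLp.norm_apply_le x i).trans hx

theorem integrable_apply_mul_aggregate_sub (hβ : 0 < β) (hB : ∀ᵐ θ ∂π₀, ‖θ - θs‖ ≤ B) {R : ℝ}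
    (hR : ∀ᵐ x ∂ν, ‖x‖ ≤ R) (i : Fin n) :
    Integrable (fun x => x i * (aggregate π₀ β (θs + x) - θs) i) ν := by
  have hx : Measurable (fun x : EuclideanSpace ℝ (Fin n) => x i) := by fun_prop
  refine integrable_of_norm_le hR
    (hx.mul (measurable_aggregate_sub_apply β θs i)).stronglyMeasurable (K := R * B)
    fun x hx => ?_
  rw [abs_mul]
  exact mul_le_mul ((PiLp.norm_apply_le x i).trans hx)
    ((PiLp.norm_apply_le (aggregate π₀ β (θs + x) - θs) i).trans (norm_aggregate_sub_le hβ hB x))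
    (abs_nonneg _) ((norm_nonneg _).trans hx)

/-- The correlation of a coordinate of the aggregate with the noise is controlled by the
posterior variance of that coordinate. -/
theorem integral_apply_mul_aggregate_sub_le (hβ : 0 < β) (hB : ∀ᵐ θ ∂π₀, ‖θ - θs‖ ≤ B)
    {S : Set (EuclideanSpace ℝ (Fin n))} (hS : ∀ᵐ θ ∂π₀, θ ∈ S) (i : Fin n)
    (hD : ∀ θ ∈ S, ∀ θ' ∈ S, |θ i - θ' i| ≤ D) (hLD : 2 * L * D < 3 * β)
    (hν : ν.map (WithLp.ofLp : EuclideanSpace ℝ (Fin n) → Fin n → ℝ) =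
      Measure.pi fun j => ν.map fun x => x j)
    (hmean : ∫ x, x i ∂ν = 0) {R : ℝ} (hR : ∀ᵐ x ∂ν, ‖x‖ ≤ R)
    (hL : ∃ a b : ℝ, b - a ≤ L ∧ ∀ᵐ x ∂ν, x i ∈ Set.Icc a b) :
    2 * ∫ x, x i * (aggregate π₀ β (θs + x) - θs) i ∂ν ≤
      6 * L ^ 2 / (3 * β - 2 * L * D) * ∫ x, coordVar π₀ β θs x i ∂ν := by
  obtain ⟨a, b, hab, hIcc⟩ := hL
  set C := 6 * L ^ 2 / (3 * β - 2 * L * D)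
  set T : EuclideanSpace ℝ (Fin n) × EuclideanSpace ℝ (Fin n) → EuclideanSpace ℝ (Fin n) :=
    fun p => p.1 + EuclideanSpace.single i (p.2 i - p.1 i) with hT
  have hmap : (ν.prod ν).map T = ν := map_add_single_prod hν i
  -- The pushforward along a map that is not a.e. measurable is zero, whereas here it is a
  -- probability measure.
  have hTm : AEMeasurable T (ν.prod ν) := by
    by_contra h
    rw [Measure.map_of_not_aemeasurable h] at hmap
    exact IsProbabilityMeasure.ne_zero ν hmap.symm
  have hG := integrable_logPartition (π₀ := π₀) hβ hB hR
  have hGT : Integrable (fun p => logPartition π₀ β θs (T p)) (ν.prod ν) := by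
    rw [← hmap] at hG
    exact hG.comp_aemeasurable hTm
  have hGTe : ∫ p, logPartition π₀ β θs (T p) ∂(ν.prod ν) = ∫ x, logPartition π₀ β θs x ∂ν := by
    rw [← integral_map hTm (stronglyMeasurable_logPartition β θs).aestronglyMeasurable, hmap]
  have hd := integrable_aggregate_sub_apply (π₀ := π₀) (ν := ν) hβ hB i
  have hxd := integrable_apply_mul_aggregate_sub (π₀ := π₀) hβ hB hR i
  have hv := integrable_coordVar (π₀ := π₀) (ν := ν) hβ hB i
  have hpt : ∀ᵐ p ∂(ν.prod ν),
      β * logPartition π₀ β θs (T p) + 2 * (p.1 i * (aggregate π₀ β (θs + p.1) - θs) i) ≤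
      (β * logPartition π₀ β θs p.1 + C * coordVar π₀ β θs p.1 i) +
        2 * ((aggregate π₀ β (θs + p.1) - θs) i * p.2 i) := by
    have h1 := Measure.quasiMeasurePreserving_fst (μ := ν) (ν := ν) |>.ae hIcc
    have h2 := Measure.quasiMeasurePreserving_snd (μ := ν) (ν := ν) |>.ae hIcc
    filter_upwards [h1, h2] with p hp1 hp2
    have ht : |p.2 i - p.1 i| ≤ L := by
      rw [abs_le]
      constructor <;> linarith [hp1.1, hp1.2, hp2.1, hp2.2]
    have := logPartition_add_single_sub_le hβ hB hS i hD hLD p.1 ht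
    simp only [hT]
    linarith
  have hl1 : Integrable (fun p => β * logPartition π₀ β θs (T p)) (ν.prod ν) := hGT.const_mul β
  have hl2 := (hxd.const_mul 2).comp_fst ν
  have hr1 : Integrable (fun p : EuclideanSpace ℝ (Fin n) × EuclideanSpace ℝ (Fin n) =>
      β * logPartition π₀ β θs p.1 + C * coordVar π₀ β θs p.1 i) (ν.prod ν) :=
    ((hG.const_mul β).add (hv.const_mul C)).comp_fst ν
  have hr2 := (hd.mul_prod (integrable_apply hR i)).const_mul 2
  have key := integral_mono_ae (hl1.add hl2) (hr1.add hr2) hpt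
  simp only [Pi.add_apply] at key
  -- The resampled and original log-partitions have equal integrals and will cancel. The cross term
  -- with `p.2 i` factorizes over the product measure and vanishes by `hmean`.
  rw [integral_add hl1 hl2, integral_add hr1 hr2, integral_const_mul β, hGTe,
    integral_fun_fst (fun x => 2 * (x i * (aggregate π₀ β (θs + x) - θs) i)),
    integral_fun_fst (fun x => β * logPartition π₀ β θs x + C * coordVar π₀ β θs x i),
    integral_add (hG.const_mul β) (hv.const_mul C), integral_const_mul 2, integral_const_mul 2,
    integral_const_mul β, integral_const_mul C,
    integral_prod_mul (fun x => (aggregate π₀ β (θs + x) - θs) i)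
      (fun x : EuclideanSpace ℝ (Fin n) => x i), hmean] at key
  simp only [probReal_univ, one_smul, mul_zero, add_zero] at key
  linarith

theorem integral_inner_eq_zero (hmean : ∀ i : Fin n, ∫ x, x i ∂ν = 0) {R : ℝ}
    (hR : ∀ᵐ x ∂ν, ‖x‖ ≤ R) (z : EuclideanSpace ℝ (Fin n)) : ∫ x, inner ℝ x z ∂ν = 0 := by
  simp only [PiLp.inner_apply, RCLike.inner_apply, conj_trivial]
  rw [integral_finsetSum _ fun i _ => (integrable_apply hR i).const_mul (z i)]
  simp [integral_const_mul, hmean]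

/-- Jensen's inequality through the subgradient at zero, whose linear term averages to zero for
centered noise. -/
theorem logPartition_zero_le_integral (hβ : 0 < β) (hB : ∀ᵐ θ ∂π₀, ‖θ - θs‖ ≤ B)
    (hmean : ∀ i : Fin n, ∫ x, x i ∂ν = 0) {R : ℝ} (hR : ∀ᵐ x ∂ν, ‖x‖ ≤ R) :
    logPartition π₀ β θs 0 ≤ ∫ x, logPartition π₀ β θs x ∂ν := by
  set z := aggregate π₀ β (θs + 0) - θs with hz
  have hi : Integrable (fun x => inner ℝ x z) ν := by
    simp only [PiLp.inner_apply, RCLike.inner_apply, conj_trivial]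
    exact integrable_finsetSum _ fun i _ => (integrable_apply hR i).const_mul (z i)
  have h1 : ∫ x, (logPartition π₀ β θs 0 + 2 / β * inner ℝ x z) ∂ν = logPartition π₀ β θs 0 := by
    rw [integral_add (integrable_const _) (hi.const_mul _), integral_const_mul,
      integral_inner_eq_zero hmean hR]
    simp
  rw [← h1]
  refine integral_mono ((integrable_const _).add (hi.const_mul _))
    (integrable_logPartition hβ hB hR) fun x => ?_
  have := le_logPartition_sub hβ hB 0 x
  rw [zero_add, ← hz] at this
  simp only
  linarith

theorem integral_norm_sq_aggregate_sub_le (hβ : 0 < β) (hB : ∀ᵐ θ ∂π₀, ‖θ - θs‖ ≤ B)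
    {S : Set (EuclideanSpace ℝ (Fin n))} (hS : ∀ᵐ θ ∂π₀, θ ∈ S)
    (hD : ∀ θ ∈ S, ∀ θ' ∈ S, ∀ i, |θ i - θ' i| ≤ D) (hLD : 2 * L * D < 3 * β)
    (hν : ν.map (WithLp.ofLp : EuclideanSpace ℝ (Fin n) → Fin n → ℝ) =
      Measure.pi fun j => ν.map fun x => x j)
    (hmean : ∀ i : Fin n, ∫ x, x i ∂ν = 0)
    (hL : ∀ i : Fin n, ∃ a b : ℝ, b - a ≤ L ∧ ∀ᵐ x ∂ν, x i ∈ Set.Icc a b) :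
    ∫ x, ‖aggregate π₀ β (θs + x) - θs‖ ^ 2 ∂ν ≤ -(β * logPartition π₀ β θs 0) +
      (6 * L ^ 2 / (3 * β - 2 * L * D) - 1) *
        ∫ x, totalVar (posterior π₀ β (θs + x)) ∂ν := by
  obtain ⟨R, hR⟩ := exists_ae_norm_le hL
  have hG := integrable_logPartition (π₀ := π₀) hβ hB hR
  have hV := integrable_totalVar (π₀ := π₀) (ν := ν) hβ hB
  have hxd := fun i => integrable_apply_mul_aggregate_sub (π₀ := π₀) hβ hB hR i
  have hsum : ∀ x : EuclideanSpace ℝ (Fin n), inner ℝ x (aggregate π₀ β (θs + x) - θs) =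
      ∑ i, x i * (aggregate π₀ β (θs + x) - θs) i := fun x => by
    simp only [PiLp.inner_apply, RCLike.inner_apply, conj_trivial, mul_comm]
  have hi : Integrable (fun x => inner ℝ x (aggregate π₀ β (θs + x) - θs)) ν := by
    simp_rw [hsum]
    exact integrable_finsetSum _ fun i _ => hxd i
  have h1 : ∫ x, ‖aggregate π₀ β (θs + x) - θs‖ ^ 2 ∂ν ≤
      2 * ∫ x, inner ℝ x (aggregate π₀ β (θs + x) - θs) ∂ν
        - ∫ x, totalVar (posterior π₀ β (θs + x)) ∂ν - β * ∫ x, logPartition π₀ β θs x ∂ν := by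
    have hiV : Integrable (fun x => 2 * inner ℝ x (aggregate π₀ β (θs + x) - θs) -
        totalVar (posterior π₀ β (θs + x))) ν := (hi.const_mul 2).sub hV
    rw [← integral_const_mul, ← integral_const_mul, ← integral_sub (hi.const_mul 2) hV,
      ← integral_sub hiV (hG.const_mul β)]
    exact integral_mono (integrable_norm_sq_aggregate_sub hβ hB)
      (hiV.sub (hG.const_mul β)) fun x => norm_sq_aggregate_sub_le hβ hB x
  have h2 : 2 * ∫ x, inner ℝ x (aggregate π₀ β (θs + x) - θs) ∂ν ≤
      6 * L ^ 2 / (3 * β - 2 * L * D) * ∫ x, totalVar (posterior π₀ β (θs + x)) ∂ν := by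
    simp_rw [hsum, ← sum_coordVar hβ hB]
    rw [integral_finsetSum _ fun i _ => hxd i,
      integral_finsetSum _ fun i _ => integrable_coordVar hβ hB i, Finset.mul_sum, Finset.mul_sum]
    exact Finset.sum_le_sum fun i _ => integral_apply_mul_aggregate_sub_le hβ hB hS i
      (fun θ hθ θ' hθ' => hD θ hθ θ' hθ' i) hLD hν (hmean i) hR (hL i)
  have h3 := mul_le_mul_of_nonneg_left
    (logPartition_zero_le_integral (π₀ := π₀) hβ hB hmean hR) hβ.le
  linarith

/-- Zero variance makes the posterior a point mass, and its positive density carries this back to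
the prior. Needed at the boundary value of `β`. -/
theorem ae_eq_aggregate_of_totalVar_eq_zero (hβ : 0 < β) (hB : ∀ᵐ θ ∂π₀, ‖θ - θs‖ ≤ B)
    {x : EuclideanSpace ℝ (Fin n)} (hx : totalVar (posterior π₀ β (θs + x)) = 0) :
    ∀ᵐ θ ∂π₀, θ = aggregate π₀ β (θs + x) := by
  have := isProbabilityMeasure_posterior hβ hB x
  refine (absolutelyContinuous_posterior hβ hB x).ae_le ?_
  rw [← sum_coordVar hβ hB, Finset.sum_eq_zero_iff_of_nonneg
    fun i _ => coordVar_nonneg hβ hB x i] at hx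
  have h : ∀ i, ∀ᵐ θ ∂(posterior π₀ β (θs + x)),
      (θ - θs) i - (aggregate π₀ β (θs + x) - θs) i = 0 := fun i => by
    have h1 := hx i (Finset.mem_univ i)
    rw [coordVar_eq hβ hB, integral_eq_zero_iff_of_nonneg (fun _ => sq_nonneg _)] at h1
    · filter_upwards [h1] with θ hθ
      simpa using hθ
    · refine integrable_posterior_of_le hβ hB x (K := (B + B) ^ 2)
        (((by fun_prop : Continuous fun θ : EuclideanSpace ℝ (Fin n) => (θ - θs) i).sub
          continuous_const).pow 2) fun θ hθ => ?_
      rw [norm_pow]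
      gcongr
      refine (norm_sub_le _ _).trans (add_le_add ((PiLp.norm_apply_le _ i).trans hθ)
        ((PiLp.norm_apply_le _ i).trans (norm_aggregate_sub_le hβ hB x)))
  filter_upwards [ae_all_iff.mpr h] with θ hθ
  ext i
  have := hθ i
  simp at this
  linarith

end Noise

end EWA

/-! ### The extended-real factor, and comparison of norms. -/

namespace EWA

theorem varianceFactor_eq_coe {L D β : ℝ} (h : 2 * L * D < 3 * β) :
    varianceFactor L D β = ((6 * L ^ 2 / (3 * β - 2 * L * D) - 1 : ℝ) : EReal) := by
  have hd : 0 < 3 * β - 2 * L * D := by linarith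
  rw [varianceFactor, ← ENNReal.ofReal_div_of_pos hd, EReal.coe_ennreal_ofReal,
    max_eq_left (by positivity)]
  push_cast
  rfl

theorem varianceFactor_eq_top {L D β : ℝ} (hL : L ≠ 0) (h : 3 * β = 2 * L * D) :
    varianceFactor L D β = ⊤ := by
  have h1 : 0 < 6 * L ^ 2 := by positivity
  rw [varianceFactor, h, sub_self, ENNReal.ofReal_zero,
    ENNReal.div_zero (ENNReal.ofReal_pos.mpr h1).ne']
  rfl

variable {n : ℕ}

theorem abs_apply_le_supNorm (v : EuclideanSpace ℝ (Fin n)) (i : Fin n) : |v i| ≤ supNorm v :=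
  norm_le_pi_norm (WithLp.ofLp v) i

theorem norm_le_mul_supNorm (v : EuclideanSpace ℝ (Fin n)) : ‖v‖ ≤ √n * supNorm v := by
  have h0 : 0 ≤ supNorm v := norm_nonneg (WithLp.ofLp v)
  refine le_of_sq_le_sq ?_ (by positivity)
  rw [EuclideanSpace.real_norm_sq_eq, mul_pow, Real.sq_sqrt (by positivity)]
  calc ∑ i, v i ^ 2 ≤ ∑ _i : Fin n, supNorm v ^ 2 := by
        refine Finset.sum_le_sum fun i _ => ?_
        rw [← sq_abs]
        gcongr
        exact abs_apply_le_supNorm v i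
    _ = n * supNorm v ^ 2 := by simp

end EWA

/-! ### Conclusion, including the boundary case `3β = 2LD₀`. -/

theorem mainTheorem4 {Ω : Type*} [MeasurableSpace Ω] (P : Measure Ω) [IsProbabilityMeasure P]
    (n : ℕ) (θstar : EuclideanSpace ℝ (Fin n))
    (ξ : Ω → EuclideanSpace ℝ (Fin n)) (hξ : AEMeasurable ξ P)
    (hindep : iIndepFun (fun (i : Fin n) (ω : Ω) => ξ ω i) P)
    (hmean : ∀ i : Fin n, ∫ ω, ξ ω i ∂P = 0)
    (L : ℝ)
    (hL : ∀ i : Fin n, ∃ a b : ℝ, b - a ≤ L ∧ ∀ᵐ ω ∂P, ξ ω i ∈ Set.Icc a b)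
    (π₀ : Measure (EuclideanSpace ℝ (Fin n))) [IsProbabilityMeasure π₀]
    (S₀ : Set (EuclideanSpace ℝ (Fin n))) (hS₀ : ∀ᵐ θ ∂π₀, θ ∈ S₀)
    (D₀ : ℝ)
    (hD₀ : IsLUB {r : ℝ | ∃ θ ∈ S₀, ∃ θ' ∈ S₀, r = EWA.supNorm (θ - θ')} D₀)
    (β : ℝ) (hβpos : 0 < β) (hβ : 2 / 3 * L * D₀ ≤ β) :
    Integrable (fun ω => ‖EWA.aggregate π₀ β (θstar + ξ ω) - θstar‖ ^ 2) P ∧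
    Integrable (fun ω => EWA.totalVar (EWA.posterior π₀ β (θstar + ξ ω))) P ∧
    ((∫ ω, ‖EWA.aggregate π₀ β (θstar + ξ ω) - θstar‖ ^ 2 ∂P : ℝ) : EReal) ≤
      (EWA.oracleBound π₀ β θstar : EReal) +
        EWA.varianceFactor L D₀ β *
          ((∫ ω, EWA.totalVar (EWA.posterior π₀ β (θstar + ξ ω)) ∂P : ℝ) : EReal) ∧
    (2 * L ^ 2 + 2 / 3 * L * D₀ ≤ β →
      EWA.varianceFactor L D₀ β *
          ((∫ ω, EWA.totalVar (EWA.posterior π₀ β (θstar + ξ ω)) ∂P : ℝ) : EReal) ≤ 0 ∧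
      ((∫ ω, ‖EWA.aggregate π₀ β (θstar + ξ ω) - θstar‖ ^ 2 ∂P : ℝ) : EReal) ≤
        (EWA.oracleBound π₀ β θstar : EReal)) := by
  have hsup : ∀ θ ∈ S₀, ∀ θ' ∈ S₀, EWA.supNorm (θ - θ') ≤ D₀ := fun θ hθ θ' hθ' =>
    hD₀.1 ⟨θ, hθ, θ', hθ', rfl⟩
  have hD : ∀ θ ∈ S₀, ∀ θ' ∈ S₀, ∀ i, |θ i - θ' i| ≤ D₀ := fun θ hθ θ' hθ' i =>
    (EWA.abs_apply_le_supNorm (θ - θ') i).trans (hsup θ hθ θ' hθ')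
  obtain ⟨θ₀, hθ₀⟩ := hS₀.exists
  obtain ⟨B, hB⟩ : ∃ B, ∀ᵐ θ ∂π₀, ‖θ - θstar‖ ≤ B := by
    refine ⟨√n * D₀ + ‖θ₀ - θstar‖, ?_⟩
    filter_upwards [hS₀] with θ hθ
    calc ‖θ - θstar‖ ≤ ‖θ - θ₀‖ + ‖θ₀ - θstar‖ := norm_sub_le_norm_sub_add_norm_sub _ _ _
      _ ≤ _ := by
        gcongr
        exact (EWA.norm_le_mul_supNorm _).trans (by gcongr; exact hsup θ hθ θ₀ hθ₀)
  -- transfer to the law of the noise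
  set ν := P.map ξ with hνdef
  have hνprob : IsProbabilityMeasure ν := Measure.isProbabilityMeasure_map hξ
  have hc : ∀ i : Fin n, Measurable (fun x : EuclideanSpace ℝ (Fin n) => x i) := fun i => by
    fun_prop
  have hcξ : ∀ i : Fin n, AEMeasurable (fun ω => ξ ω i) P := fun i =>
    (hc i).comp_aemeasurable hξ
  have hof : Measurable (WithLp.ofLp : EuclideanSpace ℝ (Fin n) → Fin n → ℝ) := by fun_prop
  have hν : ν.map (WithLp.ofLp : EuclideanSpace ℝ (Fin n) → Fin n → ℝ) =
      Measure.pi fun j => ν.map fun x => x j := by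
    have h1 := (iIndepFun_iff_map_fun_eq_pi_map hcξ).mp hindep
    rw [hνdef, AEMeasurable.map_map_of_aemeasurable hof.aemeasurable hξ]
    simp_rw [AEMeasurable.map_map_of_aemeasurable (hc _).aemeasurable hξ]
    exact h1
  have hνmean : ∀ i : Fin n, ∫ x, x i ∂ν = 0 := fun i => by
    rw [hνdef, integral_map hξ (hc i).aestronglyMeasurable]
    exact hmean i
  have hνL : ∀ i : Fin n, ∃ a b : ℝ, b - a ≤ L ∧ ∀ᵐ x ∂ν, x i ∈ Set.Icc a b := fun i => by
    obtain ⟨a, b, hab, h⟩ := hL i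
    exact ⟨a, b, hab, (ae_map_iff hξ (hc i measurableSet_Icc)).mpr h⟩
  have hvar := EWA.integrable_totalVar (π₀ := π₀) (ν := ν) hβpos hB
  have hagg := EWA.integrable_norm_sq_aggregate_sub (π₀ := π₀) (ν := ν) hβpos hB
  have hmapA : ∫ ω, ‖EWA.aggregate π₀ β (θstar + ξ ω) - θstar‖ ^ 2 ∂P =
      ∫ x, ‖EWA.aggregate π₀ β (θstar + x) - θstar‖ ^ 2 ∂ν := (integral_map hξ hagg.1).symm
  have hmapV : ∫ ω, EWA.totalVar (EWA.posterior π₀ β (θstar + ξ ω)) ∂P =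
      ∫ x, EWA.totalVar (EWA.posterior π₀ β (θstar + x)) ∂ν := (integral_map hξ hvar.1).symm
  have hV0 : 0 ≤ ∫ x, EWA.totalVar (EWA.posterior π₀ β (θstar + x)) ∂ν :=
    integral_nonneg fun x => EWA.totalVar_nonneg hβpos hB x
  have horacle := EWA.logPartition_zero_le_oracleBound hβpos hB
  have main : ((∫ x, ‖EWA.aggregate π₀ β (θstar + x) - θstar‖ ^ 2 ∂ν : ℝ) : EReal) ≤
      (EWA.oracleBound π₀ β θstar : EReal) + EWA.varianceFactor L D₀ β *
        ((∫ x, EWA.totalVar (EWA.posterior π₀ β (θstar + x)) ∂ν : ℝ) : EReal) := by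
    have hle : 2 * L * D₀ ≤ 3 * β := by linarith
    rcases hle.lt_or_eq with hlt | heq
    · have h1 := EWA.integral_norm_sq_aggregate_sub_le hβpos hB hS₀ hD hlt hν hνmean hνL
      rw [EWA.varianceFactor_eq_coe hlt, ← EReal.coe_mul]
      refine (EReal.coe_le_coe_iff.mpr h1).trans ?_
      rw [EReal.coe_add]
      gcongr
    -- `L = 0` would force `β = 0`.
    · have hL0 : L ≠ 0 := by
        rintro rfl
        linarith
      rw [EWA.varianceFactor_eq_top hL0 heq.symm]
      rcases hV0.lt_or_eq with hpos | hzero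
      · rw [EReal.top_mul_of_pos (by exact_mod_cast hpos), EReal.add_top_of_ne_bot (by simp)]
        exact le_top
      -- With zero expected variance the convention `∞ * 0 = 0` removes the last term, so a real
      -- proof is required. The prior is then a point mass, and the strict case applies with a
      -- singleton support and diameter `0`.
      · have hae := (integral_eq_zero_iff_of_nonneg
          (fun x => EWA.totalVar_nonneg hβpos hB x) hvar).mp hzero.symm
        obtain ⟨x, hx⟩ := hae.exists
        have hdirac := EWA.ae_eq_aggregate_of_totalVar_eq_zero hβpos hB hx
        have h1 := EWA.integral_norm_sq_aggregate_sub_le (D := 0) hβpos hB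
          (S := {EWA.aggregate π₀ β (θstar + x)}) hdirac (by
            rintro θ rfl θ' rfl i
            simp) (by linarith) hν hνmean hνL
        rw [← hzero] at h1 ⊢
        rw [mul_zero, add_zero] at h1
        rw [EReal.coe_zero, mul_zero, add_zero]
        exact (EReal.coe_le_coe_iff.mpr h1).trans horacle
  have hlast : 2 * L ^ 2 + 2 / 3 * L * D₀ ≤ β → EWA.varianceFactor L D₀ β *
      ((∫ x, EWA.totalVar (EWA.posterior π₀ β (θstar + x)) ∂ν : ℝ) : EReal) ≤ 0 := by
    intro h
    have hlt : 2 * L * D₀ < 3 * β := by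
      rcases eq_or_ne L 0 with rfl | hL0
      · linarith
      · have : 0 < L ^ 2 := by positivity
        linarith
    rw [EWA.varianceFactor_eq_coe hlt, ← EReal.coe_mul]
    -- Multiplied by three, the assumption on `β` reads `6L² ≤ 3β - 2LD₀`.
    have h2 : 6 * L ^ 2 / (3 * β - 2 * L * D₀) ≤ 1 := by
      rw [div_le_one (by linarith)]
      linarith
    exact_mod_cast mul_nonpos_of_nonpos_of_nonneg (by linarith) hV0
  rw [hmapA, hmapV]
  refine ⟨hagg.comp_aemeasurable hξ, hvar.comp_aemeasurable hξ, main, fun h => ⟨hlast h, ?_⟩⟩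
  calc _ ≤ _ := main
    _ ≤ (EWA.oracleBound π₀ β θstar : EReal) + 0 := by gcongr; exact hlast h
    _ = _ := add_zero _
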